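/- **Notation.** For a real $t$ and an integer $k\ge 1$ put $(-t)_k=(-t)(-t-1)\cdots(-t-k+1)$. Let $\sum_{(k,m,s)}$ denote the sum over all nonnegative integers $n_1,\dots,n_k$ with $n_1+2n_2+\cdots+kn_k=m$ and $n_1+\cdots+n_k=m-s$; $\binom{r}{n_1,\dots,n_k}$ is the multinomial coefficient. Let $\tau\ge 1$ be an integer and $f(x)=x+a_1x^{\tau+1}+a_2x^{2\tau+1}+\cdots+a_7x^{7\tau+1}+\cdots$ near $0$. Put $\lambda=-1/(\tau a_1)$, $$b_j=\lambda^{j+1}\sum_{s=0}^{j}\frac{(-\tau)_{j+1-s}}{(j+1-s)!}\sum_{(7,j+1,s)}\binom{j+1-s}{n_1,\dots,n_7}a_1^{n_1}\cdots a_7^{n_7}\quad(1\le j\le 6),$$ $$a_{0,j}=\sum_{s=0}^{j-1}\frac{(-1)^{j-1-s}}{j-s}\sum_{(7,j,s)}\binom{j-s}{n_1,\dots,n_7}1^{n_1}b_1^{n_2}\cdots b_6^{n_7}\quad(1\le j\le 6),$$ $$a_{i,j}=\sum_{s=0}^{j-i-1}\frac{(-i)_{j-i-s}}{(j-i-s)!}\sum_{(7,j-i,s)}\binom{j-i-s}{n_1,\dots,n_7}1^{n_1}b_1^{n_2}\cdots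 b_6^{n_7}\quad(1\le i<j\le 6),$$ $c_0=-b_1$ and $c_i=\frac1i\bigl(b_{i+1}+\sum_{h=0}^{i-1}a_{h,i+1}c_h\bigr)$ for $1\le i\le 5$. Define polynomials $T_1=X$, $T_2=b_1X-c_1$ and, for $2\le m\le5$, $$T_{m+1}=b_1\sum_{s=0}^{m-1}\frac{(-1)^{m-1-s}}{m-s}\sum_{(m,m,s)}\binom{m-s}{n_1,\dots,n_m}T_1^{n_1}\cdots T_m^{n_m}-c_m-\sum_{p=1}^{m-1}c_p\sum_{q=1}^{m-p}\frac{(-p)_q}{q!}\sum_{(m,m-p,m-p-q)}\binom{q}{n_1,\dots,n_m}T_1^{n_1}\cdots T_m^{n_m},$$ $\widetilde T_m(X)=T_m(-\tau X)$, and $P_0=1$, $P_1=X$ and, for $2\le m\le 6$, $$P_m=\sum_{s=0}^{m-1}\frac{(-1/\tau)_{m-s}}{(m-s)!}\sum_{(6,m,s)}\binom{m-s}{n_1,\dots,n_6}\widetilde T_1^{n_1}\cdots\widetilde T_6^{n_6}.$$ **Statement.** For $f(x)=\ln(1+x)$ (so $\tau=1$) these formulas give $\lambda=2$, $b_1=-\frac13$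 and $$P_1=X,\quad P_2=X^2-\tfrac13X+\tfrac1{18},\quad P_3=X^3-\tfrac56X^2+\tfrac5{18}X-\tfrac7{270},\quad P_4=X^4-\tfrac{13}9X^3+\tfrac56X^2-\tfrac{53}{270}X+\tfrac{67}{4860}.$$ Moreover, let $x_0>0$ and $x_n=\ln(1+x_{n-1})$ for $n\ge1$. Then there is a unique real constant $C$ (depending only on $x_0$) such that, as $n\to\infty$, both $$x_n=\left(\frac{\lambda}{n}\right)^{1/\tau}\left\{1+\sum_{m=1}^{4}P_m\!\left(-\frac1\tau\left[b_1\ln(n)+2C\right]\right)\frac1{n^m}\right\}+O\!\left(\frac{\ln(n)^5}{n^6}\right)$$ and $$\begin{aligned}x_n={}&\frac{2}{n}+\frac{2}{3}\frac{\ln(n)}{n^{2}}-\frac{4C}{n^{2}}+\frac{2}{9}\frac{\ln(n)^{2}}{n^{3}}-\left(\frac{8}{3}C+\frac{2}{9}\right)\frac{\ln(n)}{n^{3}}+\left(8C^{2}+\frac{4}{3}C+\frac{1}{9}\right)\frac{1}{n^{3}}\\ &+\frac{2}{27}\frac{\ln(n)^{3}}{n^{4}}-\left(\frac{4}{3}C+\frac{5}{27}\right)\frac{\ln(n)^{2}}{n^{4}}+\left(8C^{2}+\frac{20}{9}C+\frac{5}{27}\right)\frac{\ln(n)}{n^{4}}\\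 &-\left(16C^{3}+\frac{20}{3}C^{2}+\frac{10}{9}C+\frac{7}{135}\right)\frac{1}{n^{4}}+\frac{2}{81}\frac{\ln(n)^{4}}{n^{5}}-\left(\frac{16}{27}C+\frac{26}{243}\right)\frac{\ln(n)^{3}}{n^{5}}\\ &+\left(\frac{16}{3}C^{2}+\frac{52}{27}C+\frac{5}{27}\right)\frac{\ln(n)^{2}}{n^{5}}-\left(\frac{64}{3}C^{3}+\frac{104}{9}C^{2}+\frac{20}{9}C+\frac{53}{405}\right)\frac{\ln(n)}{n^{5}}\\ &+\left(32C^{4}+\frac{208}{9}C^{3}+\frac{20}{3}C^{2}+\frac{106}{135}C+\frac{67}{2430}\right)\frac{1}{n^{5}}+O\!\left(\frac{\ln(n)^5}{n^6}\right).\end{aligned}$$ -/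

import Mathlib

noncomputable section

namespace IterAsymp

/-- The sum over all nonnegative integers `n₁, …, n_k` with
`n₁ + 2 n₂ + ⋯ + k n_k = m` and `n₁ + n₂ + ⋯ + n_k = r` of the terms
`(multinomial coefficient r! / (n₁! ⋯ n_k!)) * v₁ ^ n₁ * ⋯ * v_k ^ n_k`.
The entry `v i`, with `i : Fin k` starting at `0`, is the mathematical `v_{i+1}`.
The index set `(k, m, s)` is the one with `r = m - s`. -/
def partSum {R : Type*} [CommSemiring R] (k m r : ℕ) (v : Fin k → R) : R :=
  ∑ n ∈ (Finset.piAntidiag (Finset.univ : Finset (Fin k)) r).filter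
      (fun n => ∑ i : Fin k, ((i : ℕ) + 1) * n i = m),
    (Nat.multinomial Finset.univ n : R) * ∏ i : Fin k, v i ^ n i

/-- `(x)_k = x (x - 1) ⋯ (x - k + 1)`. -/
def fall (x : ℝ) (k : ℕ) : ℝ := (descPochhammer ℝ k).eval x

/-- The Taylor coefficient at the origin of `f` in degree `m τ + 1`. -/
def taylorCoeff (f : ℝ → ℝ) (τ m : ℕ) : ℝ :=
  iteratedDeriv (m * τ + 1) f 0 / ((m * τ + 1).factorial : ℝ)

/-! In what follows `τ` is the gap between successive powers of `x` and
`a m` is the coefficient of `x ^ (m τ + 1)` in the Taylor series. -/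

/-- `λ = - 1 / (τ a₁)`. -/
def lam (τ : ℕ) (a : ℕ → ℝ) : ℝ := -1 / ((τ : ℝ) * a 1)

/-- The numbers `b_j`, `1 ≤ j ≤ 6`. -/
def b (τ : ℕ) (a : ℕ → ℝ) (j : ℕ) : ℝ :=
  lam τ a ^ (j + 1) * ∑ s ∈ Finset.range (j + 1),
    fall (-(τ : ℝ)) (j + 1 - s) / ((j + 1 - s).factorial : ℝ) *
      partSum 7 (j + 1) (j + 1 - s) (fun i : Fin 7 => a ((i : ℕ) + 1))

/-- The vector `(1, b₁, b₂, …, b₆)`. -/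
def oneB (τ : ℕ) (a : ℕ → ℝ) (i : Fin 7) : ℝ :=
  if (i : ℕ) = 0 then 1 else b τ a i

/-- The numbers `a_{i,j}`, `0 ≤ i < j ≤ 6`. -/
def aa (τ : ℕ) (a : ℕ → ℝ) (i j : ℕ) : ℝ :=
  if i = 0 then
    ∑ s ∈ Finset.range j, (-1 : ℝ) ^ (j - 1 - s) / ((j - s : ℕ) : ℝ) *
      partSum 7 j (j - s) (oneB τ a)
  else
    ∑ s ∈ Finset.range (j - i),
      fall (-(i : ℝ)) (j - i - s) / ((j - i - s).factorial : ℝ) *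
        partSum 7 (j - i) (j - i - s) (oneB τ a)

/-- The numbers `c_i`, `0 ≤ i ≤ 5`. -/
def c (τ : ℕ) (a : ℕ → ℝ) : ℕ → ℝ
  | 0 => -b τ a 1
  | i + 1 => 1 / ((i + 1 : ℕ) : ℝ) *
      (b τ a (i + 2) + ∑ h : Fin (i + 1), aa τ a h (i + 2) * c τ a h)
termination_by i => i
decreasing_by exact h.isLt

/-- The polynomials `T_m`, `m ≥ 1` (the value at `0` is not used). -/
def T (τ : ℕ) (a : ℕ → ℝ) : ℕ → Polynomial ℝ
  | 0 => 0
  | 1 => Polynomial.X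
  | 2 => Polynomial.C (b τ a 1) * Polynomial.X - Polynomial.C (c τ a 1)
  | l + 3 =>
      Polynomial.C (b τ a 1) *
          ∑ s ∈ Finset.range (l + 2),
            Polynomial.C ((-1 : ℝ) ^ (l + 2 - 1 - s) / ((l + 2 - s : ℕ) : ℝ)) *
              partSum (l + 2) (l + 2) (l + 2 - s)
                (fun i : Fin (l + 2) => T τ a ((i : ℕ) + 1))
        - Polynomial.C (c τ a (l + 2))
        - ∑ p ∈ Finset.Icc 1 (l + 1), Polynomial.C (c τ a p) *
            ∑ q ∈ Finset.Icc 1 (l + 2 - p),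
              Polynomial.C (fall (-(p : ℝ)) q / (q.factorial : ℝ)) *
                partSum (l + 2) (l + 2 - p) q
                  (fun i : Fin (l + 2) => T τ a ((i : ℕ) + 1))
termination_by m => m
decreasing_by all_goals exact Nat.succ_lt_succ i.isLt

/-- `T̃_m (X) = T_m (- τ X)`. -/
def Tt (τ : ℕ) (a : ℕ → ℝ) (m : ℕ) : Polynomial ℝ :=
  (T τ a m).comp (Polynomial.C (-(τ : ℝ)) * Polynomial.X)

/-- The polynomials `P_m`, `0 ≤ m ≤ 6`. -/
def P (τ : ℕ) (a : ℕ → ℝ) : ℕ → Polynomial ℝ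
  | 0 => 1
  | 1 => Polynomial.X
  | l + 2 => ∑ s ∈ Finset.range (l + 2),
      Polynomial.C (fall (-(1 / (τ : ℝ))) (l + 2 - s) / ((l + 2 - s).factorial : ℝ)) *
        partSum 6 (l + 2) (l + 2 - s) (fun i : Fin 6 => Tt τ a ((i : ℕ) + 1))

/-- `(λ / n) ^ (1/τ) * (1 + ∑_{m=1}^{M} P_m (-(1/τ) (b₁ ln n + C)) / n ^ m)`. -/
def formulaA (τ : ℕ) (a : ℕ → ℝ) (M : ℕ) (C : ℝ) (n : ℕ) : ℝ :=
  (lam τ a / (n : ℝ)) ^ (1 / (τ : ℝ)) *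
    (1 + ∑ m ∈ Finset.Icc 1 M,
      (P τ a m).eval (-(1 / (τ : ℝ)) * (b τ a 1 * Real.log n + C)) / (n : ℝ) ^ m)

/-- The Taylor coefficients `a_m` of `ln (1 + x)`, where `τ = 1`. -/
def logCoeff (m : ℕ) : ℝ := taylorCoeff (fun x : ℝ => Real.log (1 + x)) 1 m

/-- The explicit expansion, up to order `1 / n ^ 5`, of the iterates of `ln (1 + x)`. -/
def logExpansion (C : ℝ) (n : ℕ) : ℝ :=
  2 / (n : ℝ)
    + 2 / 3 * (Real.log n / (n : ℝ) ^ 2) - 4 * C / (n : ℝ) ^ 2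
    + 2 / 9 * (Real.log n ^ 2 / (n : ℝ) ^ 3)
    - (8 / 3 * C + 2 / 9) * (Real.log n / (n : ℝ) ^ 3)
    + (8 * C ^ 2 + 4 / 3 * C + 1 / 9) * (1 / (n : ℝ) ^ 3)
    + 2 / 27 * (Real.log n ^ 3 / (n : ℝ) ^ 4)
    - (4 / 3 * C + 5 / 27) * (Real.log n ^ 2 / (n : ℝ) ^ 4)
    + (8 * C ^ 2 + 20 / 9 * C + 5 / 27) * (Real.log n / (n : ℝ) ^ 4)
    - (16 * C ^ 3 + 20 / 3 * C ^ 2 + 10 / 9 * C + 7 / 135) * (1 / (n : ℝ) ^ 4)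
    + 2 / 81 * (Real.log n ^ 4 / (n : ℝ) ^ 5)
    - (16 / 27 * C + 26 / 243) * (Real.log n ^ 3 / (n : ℝ) ^ 5)
    + (16 / 3 * C ^ 2 + 52 / 27 * C + 5 / 27) * (Real.log n ^ 2 / (n : ℝ) ^ 5)
    - (64 / 3 * C ^ 3 + 104 / 9 * C ^ 2 + 20 / 9 * C + 53 / 405) *
        (Real.log n / (n : ℝ) ^ 5)
    + (32 * C ^ 4 + 208 / 9 * C ^ 3 + 20 / 3 * C ^ 2 + 106 / 135 * C + 67 / 2430) *
        (1 / (n : ℝ) ^ 5)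

end IterAsymp

end

/-! The analytic part rests on an approximate Abel function. An exact solution of
$A(\ln(1+x))=A(x)+1$ would turn the iteration into $A(x_n)=A(x_0)+n$. The truncation `abel` of the
formal solution satisfies this up to $O(x^5)$ (`abel_log_sub`). Since $n x_n\to 2$ by a Cesàro
argument, the defects along the orbit are $O(n^{-5})$. They are summable, and $A(x_n)=n+K+O(n^{-4})$
for some constant $K$.

The proposed expansion, with $C=K/2$, satisfies the same relation up to $O(\ln(n)^5/n^4)$
(`exists_logExpansion_factor`). Near $0$ the function behaves like $2/x$, so $|x-y|\le
xy\,|A(x)-A(y)|$ (`abs_sub_le_mul_abel_sub`). With both arguments $O(1/n)$, the error in $A$ gains a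
factor $n^{-2}$, which gives $O(\ln(n)^5/n^6)$. Uniqueness is read off the $n^{-2}$ term, where $C$
enters linearly.

The algebraic part is a finite computation: each partition sum is a coefficient of a power of a
polynomial (`partSum_eq_powCoeff`), and a small table of such coefficients yields all $b_j$, $c_i$,
$T_m$, $P_m$ that are needed. The two forms of the expansion then agree identically for $n\ne0$
(`formulaA_log`), so one estimate proves both. -/

open Filter Topology Asymptotics

namespace IterAsymp

/-! ### Partition sums as coefficients of powers -/

/-- The coefficient of `X ^ m` in `(w 0 * X + w 1 * X ^ 2 + ⋯) ^ r`, by recursion on `r`. -/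
def powCoeff {R : Type*} [CommSemiring R] (w : ℕ → R) : ℕ → ℕ → R
  | 0, m => if m = 0 then 1 else 0
  | r + 1, m => ∑ i ∈ Finset.range m, w i * powCoeff w r (m - 1 - i)

/-- The multinomial theorem: the condition $\sum i\,n_i=m$ selects the monomials of degree $m$. -/
lemma partSum_eq_coeff {R : Type*} [CommSemiring R] (k m r : ℕ) (v : Fin k → R) :
    partSum k m r v =
      ((∑ i : Fin k, Polynomial.C (v i) * Polynomial.X ^ ((i : ℕ) + 1)) ^ r).coeff m := by
  rw [Finset.sum_pow_eq_sum_piAntidiag, Polynomial.finsetSum_coeff, partSum,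
    Finset.sum_filter]
  refine Finset.sum_congr rfl fun n _ => ?_
  have h : (∏ i : Fin k, (Polynomial.C (v i) * Polynomial.X ^ ((i : ℕ) + 1)) ^ n i)
      = Polynomial.C (∏ i : Fin k, v i ^ n i) *
        Polynomial.X ^ (∑ i : Fin k, ((i : ℕ) + 1) * n i) := by
    simp only [mul_pow, Finset.prod_mul_distrib, ← pow_mul, Finset.prod_pow_eq_pow_sum,
      map_prod, map_pow]
  rw [h, ← Polynomial.C_eq_natCast, ← mul_assoc, ← Polynomial.C_mul, Polynomial.coeff_C_mul_X_pow]
  simp only [eq_comm]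

/-- For $m\le k$ the variables of index beyond $m$ cannot occur, so the number $k$ of variables is
immaterial and the recursion on the exponent applies. -/
lemma partSum_eq_powCoeff {R : Type*} [CommSemiring R] (w : ℕ → R) (k r : ℕ) :
    ∀ m ≤ k, partSum k m r (fun i : Fin k => w i) = powCoeff w r m := by
  simp only [partSum_eq_coeff]
  induction r with
  | zero => intro m _; simp [powCoeff, Polynomial.coeff_one]
  | succ r ih =>
    intro m hm
    rw [pow_succ', Finset.sum_mul, Polynomial.finsetSum_coeff, powCoeff,
      Finset.sum_fin_eq_sum_range, ← Finset.sum_subset (Finset.range_mono hm)]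
    · refine Finset.sum_congr rfl fun i hi => ?_
      have hi' := Finset.mem_range.1 hi
      obtain ⟨d, rfl⟩ : ∃ d, m = d + (i + 1) := ⟨m - (i + 1), by omega⟩
      rw [dif_pos (by omega), mul_assoc, Polynomial.coeff_C_mul, mul_comm (Polynomial.X ^ _),
        Polynomial.coeff_mul_X_pow, ih d (by omega)]
      congr 2
      omega
    · intro i hk hi
      rw [Finset.mem_range, not_lt] at hi
      rw [dif_pos (Finset.mem_range.1 hk), mul_assoc, Polynomial.coeff_C_mul, mul_comm (Polynomial.X ^ _),
        Polynomial.coeff_mul_X_pow',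
        if_neg (not_le.2 (Nat.lt_succ_of_le hi)), mul_zero]

lemma powCoeff_succ {R : Type*} [CommSemiring R] (w : ℕ → R) (r m : ℕ) :
    powCoeff w (r + 1) m = ∑ i ∈ Finset.range m, w i * powCoeff w r (m - 1 - i) := rfl

lemma powCoeff_eq_zero {R : Type*} [CommSemiring R] (w : ℕ → R) :
    ∀ {r m : ℕ}, m < r → powCoeff w r m = 0
  | r + 1, m, h => Finset.sum_eq_zero fun i hi => by
      rw [powCoeff_eq_zero w (by have := Finset.mem_range.1 hi; omega), mul_zero]

lemma powCoeff_one {R : Type*} [CommSemiring R] (w : ℕ → R) (m : ℕ) :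
    powCoeff w 1 (m + 1) = w m := by
  rw [powCoeff_succ, Finset.sum_eq_single m]
  · simp [powCoeff]
  · intro i hi hne
    have := Finset.mem_range.1 hi
    rw [powCoeff, if_neg (by omega), mul_zero]
  · simp

/-- This table replaces every enumeration of partitions in the computations below. -/
lemma powCoeff_values {R : Type*} [CommRing R] (w : ℕ → R) :
    (powCoeff w 1 1 = w 0) ∧
    (powCoeff w 1 2 = w 1 ∧ powCoeff w 2 2 = w 0 ^ 2) ∧
    (powCoeff w 1 3 = w 2 ∧ powCoeff w 2 3 = 2 * w 0 * w 1 ∧ powCoeff w 3 3 = w 0 ^ 3) ∧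
    (powCoeff w 1 4 = w 3 ∧ powCoeff w 2 4 = 2 * w 0 * w 2 + w 1 ^ 2 ∧
      powCoeff w 3 4 = 3 * w 0 ^ 2 * w 1 ∧ powCoeff w 4 4 = w 0 ^ 4) ∧
    (powCoeff w 1 5 = w 4 ∧ powCoeff w 2 5 = 2 * w 0 * w 3 + 2 * w 1 * w 2 ∧
      powCoeff w 3 5 = 3 * w 0 ^ 2 * w 2 + 3 * w 0 * w 1 ^ 2 ∧
      powCoeff w 4 5 = 4 * w 0 ^ 3 * w 1 ∧ powCoeff w 5 5 = w 0 ^ 5) := by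
  have h1 := powCoeff_one w
  have h11 : powCoeff w 1 1 = w 0 := h1 0
  have h12 : powCoeff w 1 2 = w 1 := h1 1
  have h13 : powCoeff w 1 3 = w 2 := h1 2
  have h14 : powCoeff w 1 4 = w 3 := h1 3
  have h15 : powCoeff w 1 5 = w 4 := h1 4
  have h22 : powCoeff w 2 2 = w 0 ^ 2 := by
    simp [powCoeff_succ w 1, Finset.sum_range_succ, powCoeff_eq_zero, h11]; ring
  have h23 : powCoeff w 2 3 = 2 * w 0 * w 1 := by
    simp [powCoeff_succ w 1, Finset.sum_range_succ, powCoeff_eq_zero, h11, h12]; ring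
  have h24 : powCoeff w 2 4 = 2 * w 0 * w 2 + w 1 ^ 2 := by
    simp [powCoeff_succ w 1, Finset.sum_range_succ, powCoeff_eq_zero, h11, h12, h13]; ring
  have h25 : powCoeff w 2 5 = 2 * w 0 * w 3 + 2 * w 1 * w 2 := by
    simp [powCoeff_succ w 1, Finset.sum_range_succ, powCoeff_eq_zero, h11, h12, h13, h14]; ring
  have h33 : powCoeff w 3 3 = w 0 ^ 3 := by
    simp [powCoeff_succ w 2, Finset.sum_range_succ, powCoeff_eq_zero, h22]; ring
  have h34 : powCoeff w 3 4 = 3 * w 0 ^ 2 * w 1 := by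
    simp [powCoeff_succ w 2, Finset.sum_range_succ, powCoeff_eq_zero, h22, h23]; ring
  have h35 : powCoeff w 3 5 = 3 * w 0 ^ 2 * w 2 + 3 * w 0 * w 1 ^ 2 := by
    simp [powCoeff_succ w 2, Finset.sum_range_succ, powCoeff_eq_zero, h22, h23, h24]; ring
  have h44 : powCoeff w 4 4 = w 0 ^ 4 := by
    simp [powCoeff_succ w 3, Finset.sum_range_succ, powCoeff_eq_zero, h33]; ring
  have h45 : powCoeff w 4 5 = 4 * w 0 ^ 3 * w 1 := by
    simp [powCoeff_succ w 3, Finset.sum_range_succ, powCoeff_eq_zero, h33, h34]; ring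
  have h55 : powCoeff w 5 5 = w 0 ^ 5 := by
    simp [powCoeff_succ w 4, Finset.sum_range_succ, powCoeff_eq_zero, h44]; ring
  exact ⟨h11, ⟨h12, h22⟩, ⟨h13, h23, h33⟩, ⟨h14, h24, h34, h44⟩, h15, h25, h35, h45, h55⟩

/-! ### The coefficients and polynomials attached to $\ln(1+x)$ -/

/-- Uniqueness of power series: the known logarithmic series and the Taylor series have the same
coefficients. -/
lemma logCoeff_eq (m : ℕ) : logCoeff m = (-1) ^ m / ((m : ℝ) + 1) := by
  have h := hasFPowerSeriesAt_log_one_add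
  have h3 := h.eq_formalMultilinearSeries h.analyticAt.hasFPowerSeriesAt
  have h4 := congrArg (fun q => FormalMultilinearSeries.coeff q (m + 1)) h3
  simp only [FormalMultilinearSeries.coeff_ofScalars] at h4
  rw [logCoeff, taylorCoeff, mul_one, ← h4]
  push_cast
  ring

lemma fall_zero (x : ℝ) : fall x 0 = 1 := by simp [fall]

lemma fall_succ (x : ℝ) (k : ℕ) : fall x (k + 1) = fall x k * (x - k) := by
  simp [fall, descPochhammer_succ_eval]

lemma lam_log : lam 1 logCoeff = 2 := by
  norm_num [lam, logCoeff_eq]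

lemma b_eq (τ : ℕ) (a : ℕ → ℝ) (j : ℕ) (hj : j ≤ 6) :
    b τ a j = lam τ a ^ (j + 1) * ∑ s ∈ Finset.range (j + 1),
      fall (-(τ : ℝ)) (j + 1 - s) / ((j + 1 - s).factorial : ℝ) *
        powCoeff (fun i => a (i + 1)) (j + 1 - s) (j + 1) := by
  unfold b
  congr 1
  refine Finset.sum_congr rfl fun s _ => ?_
  rw [partSum_eq_powCoeff (fun i => a (i + 1)) 7 _ _ (by omega)]

lemma b_log : b 1 logCoeff 1 = -1 / 3 ∧ b 1 logCoeff 2 = 1 / 3 ∧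
    b 1 logCoeff 3 = -19 / 45 ∧ b 1 logCoeff 4 = 3 / 5 := by
  obtain ⟨h11, ⟨h12, h22⟩, ⟨h13, h23, h33⟩, ⟨h14, h24, h34, h44⟩, h15, h25, h35, h45, h55⟩ :=
    powCoeff_values (fun i => logCoeff (i + 1))
  refine ⟨?_, ?_, ?_, ?_⟩ <;> rw [b_eq _ _ _ (by norm_num), lam_log] <;>
  norm_num [Finset.sum_range_succ, fall_succ, fall_zero, Nat.factorial_succ, *] <;>
  norm_num [logCoeff_eq]

lemma aa_eq (τ : ℕ) (a : ℕ → ℝ) (i j : ℕ) (hj : j ≤ 7) :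
    aa τ a i j = if i = 0 then
      ∑ s ∈ Finset.range j, (-1 : ℝ) ^ (j - 1 - s) / ((j - s : ℕ) : ℝ) *
        powCoeff (fun i => if i = 0 then 1 else b τ a i) (j - s) j
    else
      ∑ s ∈ Finset.range (j - i),
        fall (-(i : ℝ)) (j - i - s) / ((j - i - s).factorial : ℝ) *
          powCoeff (fun i => if i = 0 then 1 else b τ a i) (j - i - s) (j - i) := by
  simp only [aa, ← partSum_eq_powCoeff _ 7 _ _ hj,
    ← partSum_eq_powCoeff _ 7 _ _ ((Nat.sub_le j i).trans hj)]
  rfl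

lemma aa_log :
    aa 1 logCoeff 0 2 = -1 / 2 + b 1 logCoeff 1 ∧
    aa 1 logCoeff 0 3 = 1 / 3 - b 1 logCoeff 1 + b 1 logCoeff 2 ∧
    aa 1 logCoeff 0 4 = -1 / 4 + b 1 logCoeff 1 - b 1 logCoeff 2 - b 1 logCoeff 1 ^ 2 / 2
      + b 1 logCoeff 3 ∧
    aa 1 logCoeff 1 3 = 1 - b 1 logCoeff 1 ∧
    aa 1 logCoeff 1 4 = -1 + 2 * b 1 logCoeff 1 - b 1 logCoeff 2 ∧
    aa 1 logCoeff 2 4 = 3 - 2 * b 1 logCoeff 1 := by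
  obtain ⟨h11, ⟨h12, h22⟩, ⟨h13, h23, h33⟩, ⟨h14, h24, h34, h44⟩, -⟩ :=
    powCoeff_values (fun i => if i = 0 then 1 else b 1 logCoeff i)
  simp only [if_true, one_ne_zero, if_false, OfNat.ofNat_ne_zero] at *
  refine ⟨?_, ?_, ?_, ?_, ?_, ?_⟩ <;> rw [aa_eq _ _ _ _ (by norm_num)] <;>
  norm_num [Finset.sum_range_succ, fall_succ, fall_zero, Nat.factorial_succ, *] <;> ring

lemma c_zero (τ : ℕ) (a : ℕ → ℝ) : c τ a 0 = -b τ a 1 := by rw [c]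

lemma c_succ (τ : ℕ) (a : ℕ → ℝ) (i : ℕ) : c τ a (i + 1) = 1 / ((i + 1 : ℕ) : ℝ) *
      (b τ a (i + 2) + ∑ h ∈ Finset.range (i + 1), aa τ a h (i + 2) * c τ a h) := by
  rw [c, Fin.sum_univ_eq_sum_range (fun h => aa τ a h (i + 2) * c τ a h)]

lemma c_log : c 1 logCoeff 1 = 1 / 18 ∧ c 1 logCoeff 2 = -1 / 135 ∧
    c 1 logCoeff 3 = -1 / 972 := by
  obtain ⟨b1, b2, b3, b4⟩ := b_log
  obtain ⟨a02, a03, a04, a13, a14, a24⟩ := aa_log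
  have c1 : c 1 logCoeff 1 = 1 / 18 := by
    rw [c_succ]; norm_num [Finset.sum_range_succ, c_zero, *]
  have c2 : c 1 logCoeff 2 = -1 / 135 := by
    rw [c_succ]; norm_num [Finset.sum_range_succ, c_zero, *]
  refine ⟨c1, c2, ?_⟩
  rw [c_succ]; norm_num [Finset.sum_range_succ, c_zero, *]

lemma T_one (τ : ℕ) (a : ℕ → ℝ) : T τ a 1 = Polynomial.X := by rw [T]

lemma T_two (τ : ℕ) (a : ℕ → ℝ) :
    T τ a 2 = Polynomial.C (b τ a 1) * Polynomial.X - Polynomial.C (c τ a 1) := by rw [T]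

lemma T_add_three (τ : ℕ) (a : ℕ → ℝ) (l : ℕ) : T τ a (l + 3) =
      Polynomial.C (b τ a 1) *
          ∑ s ∈ Finset.range (l + 2),
            Polynomial.C ((-1 : ℝ) ^ (l + 2 - 1 - s) / ((l + 2 - s : ℕ) : ℝ)) *
              powCoeff (fun i => T τ a (i + 1)) (l + 2 - s) (l + 2)
        - Polynomial.C (c τ a (l + 2))
        - ∑ p ∈ Finset.Icc 1 (l + 1), Polynomial.C (c τ a p) *
            ∑ q ∈ Finset.Icc 1 (l + 2 - p),
              Polynomial.C (fall (-(p : ℝ)) q / (q.factorial : ℝ)) *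
                powCoeff (fun i => T τ a (i + 1)) q (l + 2 - p) := by
  rw [T]
  simp only [partSum_eq_powCoeff (fun i => T τ a (i + 1)) (l + 2) _ _ le_rfl,
    partSum_eq_powCoeff (fun i => T τ a (i + 1)) (l + 2) _ _ (Nat.sub_le _ _)]

lemma P_add_two (τ : ℕ) (a : ℕ → ℝ) (l : ℕ) (hl : l ≤ 4) : P τ a (l + 2) =
    ∑ s ∈ Finset.range (l + 2),
      Polynomial.C (fall (-(1 / (τ : ℝ))) (l + 2 - s) / ((l + 2 - s).factorial : ℝ)) *
        powCoeff (fun i => Tt τ a (i + 1)) (l + 2 - s) (l + 2) := by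
  rw [P]
  simp only [partSum_eq_powCoeff (fun i => Tt τ a (i + 1)) 6 _ _ (show l + 2 ≤ 6 by omega)]

/-- Working with values at a real point keeps the computation in $\mathbb R$; polynomial identities
are recovered at the end by `Polynomial.funext`. -/
lemma T_log_three_eval (x : ℝ) :
    (T 1 logCoeff 3).eval x = x ^ 2 / 6 + x / 6 + 7 / 270 := by
  obtain ⟨b1, -⟩ := b_log
  obtain ⟨c1, c2, -⟩ := c_log
  obtain ⟨h11, ⟨h12, h22⟩, ⟨h13, h23, h33⟩, -⟩ := powCoeff_values (fun i => T 1 logCoeff (i + 1))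
  rw [T_add_three _ _ 0]
  norm_num [Finset.sum_range_succ, Finset.sum_Icc_succ_top, fall_succ, fall_zero,
    Nat.factorial_succ, T_one, T_two, *]
  ring_nf

lemma T_log_four_eval (x : ℝ) :
    (T 1 logCoeff 4).eval x = -x ^ 3 / 9 - 2 * x ^ 2 / 9 - 29 * x / 270 - 13 / 1215 := by
  obtain ⟨b1, -⟩ := b_log
  obtain ⟨c1, c2, c3⟩ := c_log
  obtain ⟨h11, ⟨h12, h22⟩, ⟨h13, h23, h33⟩, -⟩ := powCoeff_values (fun i => T 1 logCoeff (i + 1))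
  rw [T_add_three _ _ 1]
  norm_num [Finset.sum_range_succ, Finset.sum_Icc_succ_top, fall_succ, fall_zero,
    Nat.factorial_succ, T_one, T_two, T_log_three_eval, *]
  ring_nf

lemma Tt_one_eval (a : ℕ → ℝ) (m : ℕ) (x : ℝ) : (Tt 1 a m).eval x = (T 1 a m).eval (-x) := by
  simp [Tt]

lemma P_one (τ : ℕ) (a : ℕ → ℝ) : P τ a 1 = Polynomial.X := by rw [P]

lemma P_log_two : P 1 logCoeff 2 =
    Polynomial.X ^ 2 - Polynomial.C (1 / 3) * Polynomial.X + Polynomial.C (1 / 18) := by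
  obtain ⟨b1, -⟩ := b_log
  obtain ⟨c1, c2, c3⟩ := c_log
  obtain ⟨h11, ⟨h12, h22⟩, -⟩ := powCoeff_values (fun i => Tt 1 logCoeff (i + 1))
  refine Polynomial.funext fun x => ?_
  rw [P_add_two _ _ 0 (by norm_num)]
  norm_num [Finset.sum_range_succ, fall_succ, fall_zero,
    Nat.factorial_succ, Tt_one_eval, T_one, T_two, *]
  ring

lemma P_log_three : P 1 logCoeff 3 =
    Polynomial.X ^ 3 - Polynomial.C (5 / 6) * Polynomial.X ^ 2
      + Polynomial.C (5 / 18) * Polynomial.X - Polynomial.C (7 / 270) := by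
  obtain ⟨b1, -⟩ := b_log
  obtain ⟨c1, c2, c3⟩ := c_log
  obtain ⟨h11, ⟨h12, h22⟩, ⟨h13, h23, h33⟩, -⟩ :=
    powCoeff_values (fun i => Tt 1 logCoeff (i + 1))
  refine Polynomial.funext fun x => ?_
  rw [P_add_two _ _ 1 (by norm_num)]
  norm_num [Finset.sum_range_succ, fall_succ, fall_zero,
    Nat.factorial_succ, Tt_one_eval, T_one, T_two, T_log_three_eval, *]
  ring

lemma P_log_four : P 1 logCoeff 4 =
    Polynomial.X ^ 4 - Polynomial.C (13 / 9) * Polynomial.X ^ 3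
      + Polynomial.C (5 / 6) * Polynomial.X ^ 2
      - Polynomial.C (53 / 270) * Polynomial.X + Polynomial.C (67 / 4860) := by
  obtain ⟨b1, -⟩ := b_log
  obtain ⟨c1, c2, c3⟩ := c_log
  obtain ⟨h11, ⟨h12, h22⟩, ⟨h13, h23, h33⟩, ⟨h14, h24, h34, h44⟩, -⟩ :=
    powCoeff_values (fun i => Tt 1 logCoeff (i + 1))
  refine Polynomial.funext fun x => ?_
  rw [P_add_two _ _ 2 (by norm_num)]
  norm_num [Finset.sum_range_succ, fall_succ, fall_zero,
    Nat.factorial_succ, Tt_one_eval, T_one, T_two, T_log_three_eval, T_log_four_eval, *]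
  ring

lemma formulaA_log (C : ℝ) {n : ℕ} (hn : n ≠ 0) :
    formulaA 1 logCoeff 4 (2 * C) n = logExpansion C n := by
  have hn' : (n : ℝ) ≠ 0 := Nat.cast_ne_zero.2 hn
  simp only [formulaA, lam_log, b_log.1, Finset.sum_Icc_succ_top, Nat.one_le_ofNat, P_one,
    P_log_two, P_log_three, P_log_four, logExpansion, Nat.reduceAdd, Finset.Icc_self,
    Finset.sum_singleton, Nat.cast_one, div_one, Real.rpow_one]
  norm_num
  field_simp
  ring

/-! ### Calculus of bounded functions along a filter -/

section Bounded

variable {α : Type*} {l : Filter α} {f g : α → ℝ}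

lemma isBigO_one_const (k : ℝ) : (fun _ : α => k) =O[l] (fun _ => (1 : ℝ)) :=
  isBigO_const_const k one_ne_zero l

lemma isBigO_one_mul (hf : f =O[l] (fun _ => (1 : ℝ))) (hg : g =O[l] (fun _ => (1 : ℝ))) :
    (fun t => f t * g t) =O[l] (fun _ => (1 : ℝ)) := by
  simpa using hf.mul hg

lemma isBigO_one_pow (hf : f =O[l] (fun _ => (1 : ℝ))) (k : ℕ) :
    (fun t => f t ^ k) =O[l] (fun _ => (1 : ℝ)) := by
  simpa using hf.pow k

lemma isBigO_one_neg (hf : f =O[l] (fun _ => (1 : ℝ))) :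
    (fun t => -f t) =O[l] (fun _ => (1 : ℝ)) := hf.neg_left

lemma isBigO_one_div_const (hf : f =O[l] (fun _ => (1 : ℝ))) (k : ℝ) :
    (fun t => f t / k) =O[l] (fun _ => (1 : ℝ)) := by
  simpa only [div_eq_mul_inv] using isBigO_one_mul hf (isBigO_one_const k⁻¹)

lemma isBigO_of_eventually_eq_mul {k : α → ℝ} (hg : g =O[l] (fun _ => (1 : ℝ)))
    (h : ∀ᶠ t in l, f t = k t * g t) : f =O[l] k := by
  have h1 : (fun t => k t * g t) =O[l] k := by simpa using (isBigO_refl k l).mul hg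
  exact h1.congr' (h.mono fun t ht => ht.symm) .rfl

end Bounded

/-! ### Expansions of $1/w$ and $\ln w$ with bounded variable coefficients -/

/-- Coefficients of the reciprocal of a power series with constant coefficient `1`. -/
lemma recip_mul_eq (ε a₁ a₂ a₃ a₄ a₅ a₆ q₁ q₂ q₃ q₄ q₅ : ℝ)
    (h₁ : q₁ + a₁ = 0) (h₂ : q₂ + a₁ * q₁ + a₂ = 0) (h₃ : q₃ + a₁ * q₂ + a₂ * q₁ + a₃ = 0)
    (h₄ : q₄ + a₁ * q₃ + a₂ * q₂ + a₃ * q₁ + a₄ = 0)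
    (h₅ : q₅ + a₁ * q₄ + a₂ * q₃ + a₃ * q₂ + a₄ * q₁ + a₅ = 0) :
    (1 + ε * a₁ + ε ^ 2 * a₂ + ε ^ 3 * a₃ + ε ^ 4 * a₄ + ε ^ 5 * a₅ + ε ^ 6 * a₆) *
      (1 + ε * q₁ + ε ^ 2 * q₂ + ε ^ 3 * q₃ + ε ^ 4 * q₄ + ε ^ 5 * q₅) =
    1 + ε ^ 6 * ((a₆ + a₅ * q₁ + a₄ * q₂ + a₃ * q₃ + a₂ * q₄ + a₁ * q₅)
      + ε * (a₆ * q₁ + a₅ * q₂ + a₄ * q₃ + a₃ * q₄ + a₂ * q₅)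
      + ε ^ 2 * (a₆ * q₂ + a₅ * q₃ + a₄ * q₄ + a₃ * q₅)
      + ε ^ 3 * (a₆ * q₃ + a₅ * q₄ + a₄ * q₅)
      + ε ^ 4 * (a₆ * q₄ + a₅ * q₅) + ε ^ 5 * (a₆ * q₅)) := by
  linear_combination ε * h₁ + ε ^ 2 * h₂ + ε ^ 3 * h₃ + ε ^ 4 * h₄ + ε ^ 5 * h₅

section Expansion

variable {α : Type*} {l : Filter α} {ε a₁ a₂ a₃ a₄ a₅ a₆ : α → ℝ}

lemma isBigO_log_one_add_sub {e : α → ℝ} (he : Tendsto e l (𝓝 0)) :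
    (fun t => Real.log (1 + e t) - (e t - e t ^ 2 / 2 + e t ^ 3 / 3 - e t ^ 4 / 4))
      =O[l] (fun t => e t ^ 5) := by
  -- Below $1/2$ the factor $1/(1-|e|)$ in the Taylor remainder is at most $2$.
  have hsmall : ∀ᶠ t in l, |e t| < 1 / 2 := by
    have := he.abs
    rw [abs_zero] at this
    exact this.eventually_lt_const (by norm_num)
  refine IsBigO.of_bound 2 (hsmall.mono fun t ht => ?_)
  have h := Real.abs_log_sub_add_sum_range_le (x := -e t) (by rw [abs_neg]; linarith) 4
  rw [abs_neg, sub_neg_eq_add] at h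
  have h2 : |e t| ^ 5 / (1 - |e t|) ≤ 2 * |e t| ^ 5 := by
    rw [div_le_iff₀ (by linarith)]
    nlinarith [pow_nonneg (abs_nonneg (e t)) 5]
  rw [Real.norm_eq_abs, Real.norm_eq_abs, abs_pow]
  refine le_trans (le_of_eq ?_) (h.trans h2)
  congr 1
  norm_num [Finset.sum_range_succ]
  ring

/-- The $q_i$ solve the Cauchy product recurrences, so $w$ times the truncation is
$1+\varepsilon^6\cdot(\text{bounded})$; dividing by $w\to1$ preserves this. Coefficients may depend
on $t$, which serves both $x\to0^+$ with constants and $n\to\infty$ with functions of $n$. -/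
lemma isBigO_inv_expansion (hε : Tendsto ε l (𝓝 0))
    (h₁ : a₁ =O[l] (fun _ => (1 : ℝ))) (h₂ : a₂ =O[l] (fun _ => (1 : ℝ)))
    (h₃ : a₃ =O[l] (fun _ => (1 : ℝ))) (h₄ : a₄ =O[l] (fun _ => (1 : ℝ)))
    (h₅ : a₅ =O[l] (fun _ => (1 : ℝ))) (h₆ : a₆ =O[l] (fun _ => (1 : ℝ)))
    {w q₁ q₂ q₃ q₄ q₅ : α → ℝ}
    (hw : ∀ t, w t = 1 + ε t * a₁ t + ε t ^ 2 * a₂ t + ε t ^ 3 * a₃ t + ε t ^ 4 * a₄ t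
      + ε t ^ 5 * a₅ t + ε t ^ 6 * a₆ t)
    (hw1 : Tendsto w l (𝓝 1))
    (e₁ : ∀ t, q₁ t = -a₁ t) (e₂ : ∀ t, q₂ t = -(a₁ t * q₁ t + a₂ t))
    (e₃ : ∀ t, q₃ t = -(a₁ t * q₂ t + a₂ t * q₁ t + a₃ t))
    (e₄ : ∀ t, q₄ t = -(a₁ t * q₃ t + a₂ t * q₂ t + a₃ t * q₁ t + a₄ t))
    (e₅ : ∀ t, q₅ t = -(a₁ t * q₄ t + a₂ t * q₃ t + a₃ t * q₂ t + a₄ t * q₁ t + a₅ t)) :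
    q₅ =O[l] (fun _ => (1 : ℝ)) ∧
    (fun t => 1 / w t - (1 + ε t * q₁ t + ε t ^ 2 * q₂ t + ε t ^ 3 * q₃ t + ε t ^ 4 * q₄ t
      + ε t ^ 5 * q₅ t)) =O[l] (fun t => ε t ^ 6) := by
  have b0 : ε =O[l] (fun _ => (1 : ℝ)) := hε.isBigO_one ℝ
  have bw : (fun t => (w t)⁻¹) =O[l] (fun _ => (1 : ℝ)) :=
    (hw1.inv₀ one_ne_zero).isBigO_one ℝ
  have b1 : q₁ =O[l] (fun _ => (1 : ℝ)) := by
    rw [funext e₁]; exact isBigO_one_neg h₁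
  have b2 : q₂ =O[l] (fun _ => (1 : ℝ)) := by
    rw [funext e₂]
    repeat' first | assumption | apply isBigO_one_neg | apply IsBigO.add | apply isBigO_one_mul
  have b3 : q₃ =O[l] (fun _ => (1 : ℝ)) := by
    rw [funext e₃]
    repeat' first | assumption | apply isBigO_one_neg | apply IsBigO.add | apply isBigO_one_mul
  have b4 : q₄ =O[l] (fun _ => (1 : ℝ)) := by
    rw [funext e₄]
    repeat' first | assumption | apply isBigO_one_neg | apply IsBigO.add | apply isBigO_one_mul
  have b5 : q₅ =O[l] (fun _ => (1 : ℝ)) := by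
    rw [funext e₅]
    repeat' first | assumption | apply isBigO_one_neg | apply IsBigO.add | apply isBigO_one_mul
  refine ⟨b5, isBigO_of_eventually_eq_mul (g := fun t => -(((a₆ t + a₅ t * q₁ t + a₄ t * q₂ t
      + a₃ t * q₃ t + a₂ t * q₄ t + a₁ t * q₅ t)
      + ε t * (a₆ t * q₁ t + a₅ t * q₂ t + a₄ t * q₃ t + a₃ t * q₄ t + a₂ t * q₅ t)
      + ε t ^ 2 * (a₆ t * q₂ t + a₅ t * q₃ t + a₄ t * q₄ t + a₃ t * q₅ t)
      + ε t ^ 3 * (a₆ t * q₃ t + a₅ t * q₄ t + a₄ t * q₅ t)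
      + ε t ^ 4 * (a₆ t * q₄ t + a₅ t * q₅ t) + ε t ^ 5 * (a₆ t * q₅ t)) * (w t)⁻¹)) ?_ ?_⟩
  · repeat' first
      | assumption | apply isBigO_one_neg | apply IsBigO.add | apply isBigO_one_pow
      | apply isBigO_one_mul
  · filter_upwards [hw1.eventually_ne one_ne_zero] with t ht
    have h := recip_mul_eq (ε t) (a₁ t) (a₂ t) (a₃ t) (a₄ t) (a₅ t) (a₆ t) (q₁ t) (q₂ t) (q₃ t)
      (q₄ t) (q₅ t) (by rw [e₁]; ring) (by rw [e₂]; ring) (by rw [e₃]; ring) (by rw [e₄]; ring)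
      (by rw [e₅]; ring)
    rw [← hw] at h
    field_simp
    linear_combination -h

lemma isBigO_log_expansion (hε : Tendsto ε l (𝓝 0))
    (h₁ : a₁ =O[l] (fun _ => (1 : ℝ))) (h₂ : a₂ =O[l] (fun _ => (1 : ℝ)))
    (h₃ : a₃ =O[l] (fun _ => (1 : ℝ))) (h₄ : a₄ =O[l] (fun _ => (1 : ℝ)))
    (h₅ : a₅ =O[l] (fun _ => (1 : ℝ))) (h₆ : a₆ =O[l] (fun _ => (1 : ℝ)))
    {w : α → ℝ}
    (hw : ∀ t, w t = 1 + ε t * a₁ t + ε t ^ 2 * a₂ t + ε t ^ 3 * a₃ t + ε t ^ 4 * a₄ t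
      + ε t ^ 5 * a₅ t + ε t ^ 6 * a₆ t)
    (hw1 : Tendsto w l (𝓝 1)) :
    (fun t => Real.log (w t) - (ε t * a₁ t + ε t ^ 2 * (a₂ t - a₁ t ^ 2 / 2)
      + ε t ^ 3 * (a₃ t - a₁ t * a₂ t + a₁ t ^ 3 / 3)
      + ε t ^ 4 * (a₄ t - a₁ t * a₃ t - a₂ t ^ 2 / 2 + a₁ t ^ 2 * a₂ t - a₁ t ^ 4 / 4)))
      =O[l] (fun t => ε t ^ 5) := by
  have b0 : ε =O[l] (fun _ => (1 : ℝ)) := hε.isBigO_one ℝ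
  -- Horner tails of $w$: $w=1+\varepsilon p$, $p=a_1+\varepsilon p_1$, and so on. They make the
  -- factor $\varepsilon^5$ of the truncation error explicit, with a bounded cofactor.
  obtain ⟨p₄, e₄⟩ : ∃ p : α → ℝ, ∀ t, p t = a₅ t + ε t * a₆ t := ⟨_, fun _ => rfl⟩
  obtain ⟨p₃, e₃⟩ : ∃ p : α → ℝ, ∀ t, p t = a₄ t + ε t * p₄ t := ⟨_, fun _ => rfl⟩
  obtain ⟨p₂, e₂⟩ : ∃ p : α → ℝ, ∀ t, p t = a₃ t + ε t * p₃ t := ⟨_, fun _ => rfl⟩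
  obtain ⟨p₁, e₁⟩ : ∃ p : α → ℝ, ∀ t, p t = a₂ t + ε t * p₂ t := ⟨_, fun _ => rfl⟩
  obtain ⟨p, e₀⟩ : ∃ p : α → ℝ, ∀ t, p t = a₁ t + ε t * p₁ t := ⟨_, fun _ => rfl⟩
  have B4 : p₄ =O[l] (fun _ => (1 : ℝ)) := by
    rw [funext e₄]; exact h₅.add (isBigO_one_mul b0 h₆)
  have B3 : p₃ =O[l] (fun _ => (1 : ℝ)) := by
    rw [funext e₃]; exact h₄.add (isBigO_one_mul b0 B4)
  have B2 : p₂ =O[l] (fun _ => (1 : ℝ)) := by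
    rw [funext e₂]; exact h₃.add (isBigO_one_mul b0 B3)
  have B1 : p₁ =O[l] (fun _ => (1 : ℝ)) := by
    rw [funext e₁]; exact h₂.add (isBigO_one_mul b0 B2)
  have B0 : p =O[l] (fun _ => (1 : ℝ)) := by
    rw [funext e₀]; exact h₁.add (isBigO_one_mul b0 B1)
  have hwp : ∀ t, w t = 1 + ε t * p t := fun t => by
    rw [hw, e₀, e₁, e₂, e₃, e₄]; ring
  have he : Tendsto (fun t => ε t * p t) l (𝓝 0) := by
    have : Tendsto (fun t => w t - 1) l (𝓝 (1 - 1)) := hw1.sub_const 1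
    rw [sub_self] at this
    exact this.congr fun t => by rw [hwp]; ring
  have hlog := isBigO_log_one_add_sub he
  have hpow : (fun t => (ε t * p t) ^ 5) =O[l] (fun t => ε t ^ 5) :=
    isBigO_of_eventually_eq_mul (isBigO_one_pow B0 5) (.of_forall fun t => mul_pow _ _ _)
  have hpoly : (fun t => (ε t * p t - (ε t * p t) ^ 2 / 2 + (ε t * p t) ^ 3 / 3
      - (ε t * p t) ^ 4 / 4) - (ε t * a₁ t + ε t ^ 2 * (a₂ t - a₁ t ^ 2 / 2)
      + ε t ^ 3 * (a₃ t - a₁ t * a₂ t + a₁ t ^ 3 / 3)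
      + ε t ^ 4 * (a₄ t - a₁ t * a₃ t - a₂ t ^ 2 / 2 + a₁ t ^ 2 * a₂ t - a₁ t ^ 4 / 4)))
      =O[l] (fun t => ε t ^ 5) := by
    refine isBigO_of_eventually_eq_mul (g := fun t => p₄ t
      - (2 * a₁ t * p₃ t + p₂ t * (2 * a₂ t + ε t * p₂ t)) / 2
      + (3 * a₁ t ^ 2 * p₂ t + 3 * a₁ t * p₁ t ^ 2 + ε t * p₁ t ^ 3) / 3
      - p₁ t * (p t ^ 3 + p t ^ 2 * a₁ t + p t * a₁ t ^ 2 + a₁ t ^ 3) / 4) ?_ ?_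
    · repeat' first
        | assumption | exact isBigO_one_const _ | apply IsBigO.sub | apply IsBigO.add
        | apply isBigO_one_div_const | apply isBigO_one_pow | apply isBigO_one_mul
    · refine .of_forall fun t => ?_
      rw [e₀, e₁, e₂, e₃]
      ring
  refine ((hlog.trans hpow).add hpoly).congr_left fun t => ?_
  rw [hwp]
  ring

end Expansion

/-! ### The approximate Abel function -/

/-- An approximate Abel function of `ln (1 + x)`: it grows by `1 + O(x ^ 5)` along one step of the
iteration. -/
noncomputable def abel (x : ℝ) : ℝ :=
  2 / x + 1 / 3 * Real.log (2 / x) + x / 36 - x ^ 2 / 540 - x ^ 3 / 7776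

lemma exists_log_expansion : ∃ r : ℝ → ℝ, r =O[𝓝[>] 0] (fun _ => (1 : ℝ)) ∧
    ∀ x, 0 < x → Real.log (1 + x) = x * (1 + x * (-1 / 2) + x ^ 2 * (1 / 3) + x ^ 3 * (-1 / 4)
      + x ^ 4 * (1 / 5) + x ^ 5 * (-1 / 6) + x ^ 6 * r x) := by
  refine ⟨fun x => (Real.log (1 + x) / x - (1 + x * (-1 / 2) + x ^ 2 * (1 / 3) + x ^ 3 * (-1 / 4)
      + x ^ 4 * (1 / 5) + x ^ 5 * (-1 / 6))) / x ^ 6, ?_, fun x hx => by field_simp; ring⟩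
  refine IsBigO.of_bound 2 ?_
  filter_upwards [Ioo_mem_nhdsGT (show (0 : ℝ) < 1 / 2 by norm_num)] with x hx
  obtain ⟨hx0, hx1⟩ := hx
  have h := Real.abs_log_sub_add_sum_range_le (x := -x)
    (by rw [abs_neg, abs_of_pos hx0]; linarith) 6
  rw [abs_neg, sub_neg_eq_add, abs_of_pos hx0, le_div_iff₀ (by linarith)] at h
  have key : (Real.log (1 + x) / x - (1 + x * (-1 / 2) + x ^ 2 * (1 / 3) + x ^ 3 * (-1 / 4)
      + x ^ 4 * (1 / 5) + x ^ 5 * (-1 / 6))) / x ^ 6 =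
      ((∑ i ∈ Finset.range 6, (-x) ^ (i + 1) / ((i : ℝ) + 1)) + Real.log (1 + x)) / x ^ 7 := by
    norm_num [Finset.sum_range_succ]
    field_simp
    ring
  rw [key, Real.norm_eq_abs, abs_div, abs_of_pos (pow_pos hx0 7), norm_one, mul_one,
    div_le_iff₀ (pow_pos hx0 7)]
  nlinarith [abs_nonneg ((∑ i ∈ Finset.range 6, (-x) ^ (i + 1) / ((i : ℝ) + 1))
    + Real.log (1 + x))]

/-- With $\ln(1+x)=x\,g(x)$, the increment is a combination of $1/g$, $\ln g$ and powers of $g$. The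
coefficients $1/3$, $1/36$, $-1/540$, $-1/7776$ are the ones that cancel the terms in
$x,x^2,x^3,x^4$. -/
lemma abel_log_sub : (fun x => abel (Real.log (1 + x)) - abel x - 1) =O[𝓝[>] 0]
    (fun x : ℝ => x ^ 5) := by
  obtain ⟨r, hr, hlog⟩ := exists_log_expansion
  have hx0 : Tendsto (fun x : ℝ => x) (𝓝[>] 0) (𝓝 0) := nhdsWithin_le_nhds
  have bx : (fun x : ℝ => x) =O[𝓝[>] 0] (fun _ => (1 : ℝ)) := hx0.isBigO_one ℝ
  obtain ⟨g, hg⟩ : ∃ g : ℝ → ℝ, ∀ x, g x = 1 + x * (-1 / 2) + x ^ 2 * (1 / 3) + x ^ 3 * (-1 / 4)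
      + x ^ 4 * (1 / 5) + x ^ 5 * (-1 / 6) + x ^ 6 * r x := ⟨_, fun _ => rfl⟩
  obtain ⟨s, hs⟩ : ∃ s : ℝ → ℝ, ∀ x, s x = 1 / 5 - x / 6 + x ^ 2 * r x := ⟨_, fun _ => rfl⟩
  obtain ⟨p₂, hp₂⟩ : ∃ p : ℝ → ℝ, ∀ x, p x = -1 / 4 + x * s x := ⟨_, fun _ => rfl⟩
  obtain ⟨p₁, hp₁⟩ : ∃ p : ℝ → ℝ, ∀ x, p x = 1 / 3 + x * p₂ x := ⟨_, fun _ => rfl⟩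
  obtain ⟨p, hp⟩ : ∃ p : ℝ → ℝ, ∀ x, p x = -1 / 2 + x * p₁ x := ⟨_, fun _ => rfl⟩
  have bs : s =O[𝓝[>] 0] (fun _ => (1 : ℝ)) := by
    rw [funext hs]
    repeat' first
        | assumption | exact isBigO_one_const _ | apply IsBigO.sub | apply IsBigO.add
        | apply isBigO_one_div_const | apply isBigO_one_pow | apply isBigO_one_mul
  have bp₂ : p₂ =O[𝓝[>] 0] (fun _ => (1 : ℝ)) := by
    rw [funext hp₂]; exact (isBigO_one_const _).add (isBigO_one_mul bx bs)
  have bp₁ : p₁ =O[𝓝[>] 0] (fun _ => (1 : ℝ)) := by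
    rw [funext hp₁]; exact (isBigO_one_const _).add (isBigO_one_mul bx bp₂)
  have bp : p =O[𝓝[>] 0] (fun _ => (1 : ℝ)) := by
    rw [funext hp]; exact (isBigO_one_const _).add (isBigO_one_mul bx bp₁)
  have hgp : ∀ x, g x = 1 + x * p x := fun x => by rw [hg, hp, hp₁, hp₂, hs]; ring
  have hg1 : Tendsto g (𝓝[>] 0) (𝓝 1) := by
    have h : Tendsto (fun x => x * p x) (𝓝[>] 0) (𝓝 0) := by
      have := (isBigO_refl (fun x : ℝ => x) (𝓝[>] 0)).mul bp
      simp only [mul_one] at this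
      exact this.trans_tendsto hx0
    rw [funext hgp]
    simpa using h.const_add 1
  -- The $q_i$ are the coefficients of $x/\ln(1+x)$. The remainder must be $O(x^6)$ because $1/g$ is
  -- multiplied by $2/x$.
  have hinv := (isBigO_inv_expansion (q₁ := fun _ => 1 / 2) (q₂ := fun _ => -1 / 12)
    (q₃ := fun _ => 1 / 24) (q₄ := fun _ => -19 / 720) (q₅ := fun _ => 3 / 160) hx0
    (isBigO_one_const _) (isBigO_one_const _) (isBigO_one_const _) (isBigO_one_const _)
    (isBigO_one_const _) hr hg hg1 (fun _ => by norm_num) (fun _ => by norm_num)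
    (fun _ => by norm_num) (fun _ => by norm_num) (fun _ => by norm_num)).2
  have hlg := isBigO_log_expansion hx0
    (isBigO_one_const _) (isBigO_one_const _) (isBigO_one_const _) (isBigO_one_const _)
    (isBigO_one_const _) hr hg hg1
  obtain ⟨E₁, hE₁⟩ : ∃ E : ℝ → ℝ, ∀ x, E x = 1 / g x - (1 + x * (1 / 2) + x ^ 2 * (-1 / 12)
      + x ^ 3 * (1 / 24) + x ^ 4 * (-19 / 720) + x ^ 5 * (3 / 160)) := ⟨_, fun _ => rfl⟩
  rw [← funext hE₁] at hinv
  have hE₁' : (fun x => 2 * (E₁ x / x)) =O[𝓝[>] 0] (fun x : ℝ => x ^ 5) := by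
    refine IsBigO.const_mul_left ?_ 2
    refine (hinv.mul (isBigO_refl (fun x : ℝ => x⁻¹) _)).congr' (.of_forall fun x => rfl) ?_
    filter_upwards [self_mem_nhdsWithin] with x hx
    have : x ≠ 0 := ne_of_gt hx
    field_simp
  -- What the polynomial part of `abel` leaves once all powers below $x^5$ have cancelled.
  have hrest : (fun x => x ^ 5 * (s x / 36 - (2 * p₂ x - p₁ x + x * p₁ x ^ 2) / 540
      - (3 * p₁ x + 3 * p x ^ 2 + x * p x ^ 3) / 7776)) =O[𝓝[>] 0] (fun x : ℝ => x ^ 5) := by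
    refine isBigO_of_eventually_eq_mul ?_ (.of_forall fun x => rfl)
    repeat' first
        | assumption | exact isBigO_one_const _ | apply IsBigO.sub | apply IsBigO.add
        | apply isBigO_one_div_const | apply isBigO_one_pow | apply isBigO_one_mul
  refine ((hE₁'.sub (hlg.const_mul_left (1 / 3))).add hrest).congr' ?_ .rfl
  filter_upwards [self_mem_nhdsWithin, hg1.eventually_ne one_ne_zero] with x hx hgx
  have hx' : x ≠ 0 := ne_of_gt hx
  have hlog2 : Real.log (2 / (x * g x)) = Real.log (2 / x) - Real.log (g x) := by
    rw [← div_div, Real.log_div (div_ne_zero two_ne_zero hx') hgx]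
  rw [hlog x hx, ← hg, abel, abel, hlog2, hE₁]
  have h1 : 2 / (x * g x) = 2 / x * (1 / g x) := by field_simp
  rw [h1]
  generalize 1 / g x = v
  generalize Real.log (g x) = u
  generalize Real.log (2 / x) = z
  rw [hgp, hp, hp₁, hp₂]
  field_simp
  ring

/-- The term $2/x$ contributes exactly $2(y-x)$. The logarithm and the terms in $x^2,x^3$ contribute
with the favourable sign, and the increasing term $x/36$ costs at most $(y-x)/36$. -/
lemma sub_le_mul_abel_sub {x y : ℝ} (hx : 0 < x) (hxy : x ≤ y) (hy : y ≤ 1) :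
    y - x ≤ x * y * (abel x - abel y) := by
  have hy0 : 0 < y := hx.trans_le hxy
  have hlog : Real.log (2 / y) ≤ Real.log (2 / x) := by gcongr
  have h1 : x * y * (2 / x - 2 / y) = 2 * (y - x) := by field_simp
  have h2 : x * y * (1 / 3 * (Real.log (2 / x) - Real.log (2 / y))) ≥ 0 :=
    mul_nonneg (mul_pos hx hy0).le (by linarith)
  have hx2 : x ^ 2 ≤ y ^ 2 := by gcongr
  have hx3 : x ^ 3 ≤ y ^ 3 := by gcongr
  have h3 : x * y * (y - x) ≤ 1 * (y - x) := by
    gcongr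
    nlinarith
  have h4 : 0 ≤ x * y * ((y ^ 2 - x ^ 2) / 540 + (y ^ 3 - x ^ 3) / 7776) :=
    mul_nonneg (mul_pos hx hy0).le (by linarith)
  unfold abel
  linarith

lemma abs_sub_le_mul_abel_sub {x y : ℝ} (hx : 0 < x) (hy : 0 < y) (hx1 : x ≤ 1) (hy1 : y ≤ 1) :
    |x - y| ≤ x * y * |abel x - abel y| := by
  rcases le_total x y with h | h
  · rw [abs_sub_comm, abs_of_nonneg (sub_nonneg.2 h)]
    exact (sub_le_mul_abel_sub hx h hy1).trans (by gcongr; exact le_abs_self _)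
  · rw [abs_of_nonneg (sub_nonneg.2 h), abs_sub_comm (abel x), mul_comm x]
    exact (sub_le_mul_abel_sub hy h hx1).trans (by gcongr; exact le_abs_self _)

/-! ### The Abel function along the proposed expansion -/

lemma tendsto_log_div_natCast : Tendsto (fun n : ℕ => Real.log n / n) atTop (𝓝 0) := by
  have h := (Real.isLittleO_log_id_atTop.tendsto_div_nhds_zero).comp tendsto_natCast_atTop_atTop
  exact h

lemma tendsto_inv_log_natCast : Tendsto (fun n : ℕ => 1 / Real.log n) atTop (𝓝 0) := by
  simp only [one_div]
  exact (Real.tendsto_log_atTop.comp tendsto_natCast_atTop_atTop).inv_tendsto_atTop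

/-- Set $\varepsilon=\ln n/n$ and $l=1/\ln n$, so that $1/n=\varepsilon l$ and the argument of $P_m$
is $y/l$ with $y=1/3-2Cl$. Then $w$ becomes a polynomial in $\varepsilon$ with bounded coefficients,
and the general expansions apply. The bound $n\ge2$ ensures $\ln n\ne0$. -/
lemma exists_logExpansion_factor (C : ℝ) : ∃ w : ℕ → ℝ, Tendsto w atTop (𝓝 1) ∧
    (∀ n, 2 ≤ n → logExpansion C n = 2 / n * w n) ∧
    (fun n : ℕ => abel (2 / n * w n) - n - 2 * C)
      =O[atTop] (fun n : ℕ => Real.log n ^ 5 / (n : ℝ) ^ 4) := by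
  obtain ⟨ε, hε⟩ : ∃ f : ℕ → ℝ, ∀ n, f n = Real.log n / n := ⟨_, fun _ => rfl⟩
  obtain ⟨l, hl⟩ : ∃ f : ℕ → ℝ, ∀ n, f n = 1 / Real.log n := ⟨_, fun _ => rfl⟩
  obtain ⟨y, hy⟩ : ∃ f : ℕ → ℝ, ∀ n, f n = 1 / 3 - 2 * C * l n := ⟨_, fun _ => rfl⟩
  have hε0 : Tendsto ε atTop (𝓝 0) := by rw [funext hε]; exact tendsto_log_div_natCast
  have hl0 : Tendsto l atTop (𝓝 0) := by rw [funext hl]; exact tendsto_inv_log_natCast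
  have bε : ε =O[atTop] (fun _ => (1 : ℝ)) := hε0.isBigO_one ℝ
  have bl : l =O[atTop] (fun _ => (1 : ℝ)) := hl0.isBigO_one ℝ
  have byy : y =O[atTop] (fun _ => (1 : ℝ)) := by
    rw [funext hy]
    exact (isBigO_one_const _).sub (isBigO_one_mul (isBigO_one_const _) bl)
  -- The $a_m$ are the homogenised polynomials $l^mP_m(y/l)$, so that $P_m/n^m=\varepsilon^m a_m$.
  obtain ⟨a₂, ha₂⟩ : ∃ f : ℕ → ℝ, ∀ n, f n = y n ^ 2 - y n * l n / 3 + l n ^ 2 / 18 :=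
    ⟨_, fun _ => rfl⟩
  obtain ⟨a₃, ha₃⟩ : ∃ f : ℕ → ℝ, ∀ n, f n = y n ^ 3 - 5 / 6 * (y n ^ 2 * l n)
      + 5 / 18 * (y n * l n ^ 2) - 7 / 270 * l n ^ 3 := ⟨_, fun _ => rfl⟩
  obtain ⟨a₄, ha₄⟩ : ∃ f : ℕ → ℝ, ∀ n, f n = y n ^ 4 - 13 / 9 * (y n ^ 3 * l n)
      + 5 / 6 * (y n ^ 2 * l n ^ 2) - 53 / 270 * (y n * l n ^ 3) + 67 / 4860 * l n ^ 4 :=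
    ⟨_, fun _ => rfl⟩
  have b2 : a₂ =O[atTop] (fun _ => (1 : ℝ)) := by
    rw [funext ha₂]
    repeat' first
        | assumption | exact isBigO_one_const _ | apply IsBigO.sub | apply IsBigO.add
        | apply isBigO_one_div_const | apply isBigO_one_pow | apply isBigO_one_mul
  have b3 : a₃ =O[atTop] (fun _ => (1 : ℝ)) := by
    rw [funext ha₃]
    repeat' first
        | assumption | exact isBigO_one_const _ | apply IsBigO.sub | apply IsBigO.add
        | apply isBigO_one_div_const | apply isBigO_one_pow | apply isBigO_one_mul
  have b4 : a₄ =O[atTop] (fun _ => (1 : ℝ)) := by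
    rw [funext ha₄]
    repeat' first
        | assumption | exact isBigO_one_const _ | apply IsBigO.sub | apply IsBigO.add
        | apply isBigO_one_div_const | apply isBigO_one_pow | apply isBigO_one_mul
  obtain ⟨v₂, hv₂⟩ : ∃ f : ℕ → ℝ, ∀ n, f n = a₃ n + ε n * a₄ n := ⟨_, fun _ => rfl⟩
  obtain ⟨v₁, hv₁⟩ : ∃ f : ℕ → ℝ, ∀ n, f n = a₂ n + ε n * v₂ n := ⟨_, fun _ => rfl⟩
  obtain ⟨v, hv⟩ : ∃ f : ℕ → ℝ, ∀ n, f n = y n + ε n * v₁ n := ⟨_, fun _ => rfl⟩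
  have bv₂ : v₂ =O[atTop] (fun _ => (1 : ℝ)) := by
    rw [funext hv₂]; exact b3.add (isBigO_one_mul bε b4)
  have bv₁ : v₁ =O[atTop] (fun _ => (1 : ℝ)) := by
    rw [funext hv₁]; exact b2.add (isBigO_one_mul bε bv₂)
  have bv : v =O[atTop] (fun _ => (1 : ℝ)) := by
    rw [funext hv]; exact byy.add (isBigO_one_mul bε bv₁)
  -- The zero terms only match the shape required by the expansion lemmas.
  obtain ⟨w, hw⟩ : ∃ f : ℕ → ℝ, ∀ n, f n = 1 + ε n * y n + ε n ^ 2 * a₂ n + ε n ^ 3 * a₃ n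
      + ε n ^ 4 * a₄ n + ε n ^ 5 * 0 + ε n ^ 6 * 0 := ⟨_, fun _ => rfl⟩
  have hwv : ∀ n, w n = 1 + ε n * v n := fun n => by rw [hw, hv, hv₁, hv₂]; ring
  have hw1 : Tendsto w atTop (𝓝 1) := by
    have h : Tendsto (fun n => ε n * v n) atTop (𝓝 0) := by
      have := (isBigO_refl ε atTop).mul bv
      simp only [mul_one] at this
      exact this.trans_tendsto hε0
    rw [funext hwv]
    simpa using h.const_add 1
  refine ⟨w, hw1, fun n hn => ?_, ?_⟩
  · have hn0 : (n : ℝ) ≠ 0 := by positivity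
    have hL : Real.log n ≠ 0 := (Real.log_pos (by exact_mod_cast hn)).ne'
    rw [logExpansion, hw, ha₂, ha₃, ha₄, hy, hl, hε]
    generalize Real.log n = L at *
    field_simp
    ring
  obtain ⟨q₂, e₂⟩ : ∃ f : ℕ → ℝ, ∀ n, f n = -(y n * (-y n) + a₂ n) := ⟨_, fun _ => rfl⟩
  obtain ⟨q₃, e₃⟩ : ∃ f : ℕ → ℝ, ∀ n, f n = -(y n * q₂ n + a₂ n * (-y n) + a₃ n) :=
    ⟨_, fun _ => rfl⟩
  obtain ⟨q₄, e₄⟩ : ∃ f : ℕ → ℝ, ∀ n, f n = -(y n * q₃ n + a₂ n * q₂ n + a₃ n * (-y n) + a₄ n) :=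
    ⟨_, fun _ => rfl⟩
  obtain ⟨q₅, e₅⟩ : ∃ f : ℕ → ℝ, ∀ n, f n = -(y n * q₄ n + a₂ n * q₃ n + a₃ n * q₂ n
      + a₄ n * (-y n) + 0) := ⟨_, fun _ => rfl⟩
  obtain ⟨bq₅, hinv⟩ := isBigO_inv_expansion (q₁ := fun n => -y n) hε0 byy b2 b3 b4
    (isBigO_one_const 0) (isBigO_one_const 0) hw hw1 (fun _ => rfl) e₂ e₃ e₄ e₅
  have hlg := isBigO_log_expansion hε0 byy b2 b3 b4
    (isBigO_one_const 0) (isBigO_one_const 0) hw hw1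
  obtain ⟨E₁, hE₁⟩ : ∃ E : ℕ → ℝ, ∀ n, E n = 1 / w n - (1 + ε n * -y n + ε n ^ 2 * q₂ n
      + ε n ^ 3 * q₃ n + ε n ^ 4 * q₄ n + ε n ^ 5 * q₅ n) := ⟨_, fun _ => rfl⟩
  rw [← funext hE₁] at hinv
  obtain ⟨E₂, hE₂⟩ : ∃ E : ℕ → ℝ, ∀ n, E n = Real.log (w n) -
      (ε n * y n + ε n ^ 2 * (a₂ n - y n ^ 2 / 2)
      + ε n ^ 3 * (a₃ n - y n * a₂ n + y n ^ 3 / 3)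
      + ε n ^ 4 * (a₄ n - y n * a₃ n - a₂ n ^ 2 / 2 + y n ^ 2 * a₂ n - y n ^ 4 / 4)) :=
    ⟨_, fun _ => rfl⟩
  rw [← funext hE₂] at hlg
  have hlarge : ∀ᶠ n : ℕ in atTop, (n : ℝ) ≠ 0 ∧ Real.log n ≠ 0 := by
    filter_upwards [eventually_ge_atTop 2] with n hn
    exact ⟨by positivity, (Real.log_pos (by exact_mod_cast hn)).ne'⟩
  have hpow : ∀ k, (fun n => ε n ^ (4 + k)) =O[atTop] (fun n => ε n ^ 4) := fun k =>
    isBigO_of_eventually_eq_mul (isBigO_one_pow bε k) (.of_forall fun n => pow_add _ _ _)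
  have hE₁' : (fun n => E₁ n / ε n) =O[atTop] (fun n => ε n ^ 4) := by
    refine ((hinv.mul (isBigO_refl (fun n => (ε n)⁻¹) _)).congr' (.of_forall fun n => rfl)
      ?_).trans (hpow 1)
    filter_upwards [hlarge] with n hn
    have : ε n ≠ 0 := by rw [hε]; exact div_ne_zero hn.2 hn.1
    field_simp
  have hE₂' : (fun n => l n * E₂ n) =O[atTop] (fun n => ε n ^ 4) := by
    have := bl.mul (hlg.trans (hpow 1))
    simpa only [one_mul] using this
  -- The terms of order $\varepsilon^4$ and higher that survive after division by $\ln n$; $q_5$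
  -- appears because $n\varepsilon^5=\ln(n)\,\varepsilon^4$.
  have hrest : (fun n => ε n ^ 4 * (q₅ n
      - l n * (a₄ n - y n * a₃ n - a₂ n ^ 2 / 2 + y n ^ 2 * a₂ n - y n ^ 4 / 4) / 3
      + l n ^ 2 * v₂ n / 18 - l n ^ 3 * (2 * v₁ n + v n ^ 2) / 135
      - l n ^ 4 * (3 * v n + 3 * (ε n * v n ^ 2) + ε n ^ 2 * v n ^ 3) / 972))
      =O[atTop] (fun n => ε n ^ 4) := by
    refine isBigO_of_eventually_eq_mul ?_ (.of_forall fun x => rfl)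
    repeat' first
        | assumption | exact isBigO_one_const _ | apply IsBigO.sub | apply IsBigO.add
        | apply isBigO_one_div_const | apply isBigO_one_pow | apply isBigO_one_mul
  have hsum := (hE₁'.sub (hE₂'.const_mul_left (1 / 3))).add hrest
  refine ((isBigO_refl (fun n : ℕ => Real.log n) atTop).mul hsum).congr' ?_ ?_
  · filter_upwards [hlarge, hw1.eventually_ne one_ne_zero] with n ⟨hn, hL⟩ hwn
    have hlog : Real.log (2 / (2 / n * w n)) = Real.log n - Real.log (w n) := by
      rw [← Real.log_div hn hwn]
      congr 1
      field_simp
    have hinv' : 2 / (2 / n * w n) = n * (1 / w n) := by field_simp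
    have hlogw : Real.log (w n) = E₂ n + (ε n * y n + ε n ^ 2 * (a₂ n - y n ^ 2 / 2)
      + ε n ^ 3 * (a₃ n - y n * a₂ n + y n ^ 3 / 3)
      + ε n ^ 4 * (a₄ n - y n * a₃ n - a₂ n ^ 2 / 2 + y n ^ 2 * a₂ n - y n ^ 4 / 4)) := by
      rw [hE₂]; ring
    have hwi : 1 / w n = E₁ n + (1 + ε n * -y n + ε n ^ 2 * q₂ n
      + ε n ^ 3 * q₃ n + ε n ^ 4 * q₄ n + ε n ^ 5 * q₅ n) := by rw [hE₁]; ring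
    have hln : l n ≠ 0 := by rw [hl]; exact one_div_ne_zero hL
    have hεn : ε n ≠ 0 := by rw [hε]; exact div_ne_zero hL hn
    -- Everything is rewritten in $\varepsilon,l,y$, which turns the claim into an identity of
    -- rational functions.
    have hLl : Real.log n = 1 / l n := by rw [hl, one_div_one_div]
    have hnl : (n : ℝ) = 1 / (ε n * l n) := by rw [hε, hl]; field_simp
    have hC : 2 * C = (1 / 3 - y n) / l n := by rw [hy]; field_simp; ring
    have hw2 : w n ^ 2 = 1 + ε n * (2 * y n) + ε n ^ 2 * (2 * v₁ n + v n ^ 2) := by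
      rw [hwv, hv]; ring
    have hw3 : w n ^ 3 = 1 + ε n * (3 * v n + 3 * (ε n * v n ^ 2) + ε n ^ 2 * v n ^ 3) := by
      rw [hwv]; ring
    have hwn' : w n = 1 + ε n * y n + ε n ^ 2 * a₂ n + ε n ^ 3 * v₂ n := by
      rw [hwv, hv, hv₁]; ring
    have habel : abel (2 / n * w n) = n * (1 / w n) + 1 / 3 * (Real.log n - Real.log (w n))
        + 2 / n * w n / 36 - 4 / n ^ 2 * w n ^ 2 / 540 - 8 / n ^ 3 * w n ^ 3 / 7776 := by
      rw [abel, hlog, hinv']; ring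
    rw [habel, hwi, hlogw, hw2, hw3, hwn', hC, hLl, hnl]
    generalize E₁ n = e1 at *
    generalize E₂ n = e2 at *
    generalize v n = v' at *
    generalize v₁ n = v1' at *
    generalize v₂ n = v2' at *
    generalize q₅ n = q5 at *
    rw [e₄, e₃, e₂, ha₄, ha₃, ha₂]
    generalize y n = y at *
    generalize l n = l at *
    generalize ε n = ε at *
    field_simp
    ring
  · refine .of_forall fun n => ?_
    simp only [hε]
    ring

/-! ### First-order behaviour of the iterates -/

section Iteration

variable {x : ℕ → ℝ}

lemma iterate_pos (h0 : 0 < x 0) (hx : ∀ n, x (n + 1) = Real.log (1 + x n)) :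
    ∀ n, 0 < x n
  | 0 => h0
  | n + 1 => by
    rw [hx]
    exact Real.log_pos (by linarith [iterate_pos h0 hx n])

/-- The sequence decreases and its limit is a fixed point of $\ln(1+x)$ on $[0,\infty)$, where $0$
is the only one. -/
lemma iterate_tendsto (h0 : 0 < x 0) (hx : ∀ n, x (n + 1) = Real.log (1 + x n)) :
    Tendsto x atTop (𝓝[>] 0) := by
  have hpos := iterate_pos h0 hx
  refine tendsto_nhdsWithin_iff.2 ⟨?_, .of_forall hpos⟩
  have hanti : Antitone x := antitone_nat_of_succ_le fun n => by
    rw [hx]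
    have := Real.log_le_sub_one_of_pos (show 0 < 1 + x n by linarith [hpos n])
    linarith
  obtain ⟨c, hc⟩ : ∃ c, Tendsto x atTop (𝓝 c) :=
    ⟨_, tendsto_atTop_ciInf hanti ⟨0, by rintro _ ⟨n, rfl⟩; exact (hpos n).le⟩⟩
  have hc0 : 0 ≤ c := ge_of_tendsto' hc fun n => (hpos n).le
  have hc1 : Tendsto (fun n => x (n + 1)) atTop (𝓝 (Real.log (1 + c))) := by
    simp only [hx]
    exact (hc.const_add 1).log (by linarith)
  have hfix : c = Real.log (1 + c) := tendsto_nhds_unique ((tendsto_add_atTop_iff_nat 1).2 hc) hc1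
  rcases hc0.eq_or_lt with h | h
  · rwa [← h] at hc
  · have := Real.log_lt_sub_one_of_pos (show 0 < 1 + c by linarith) (by linarith)
    linarith

lemma tendsto_mul_abel : Tendsto (fun t : ℝ => t * abel t) (𝓝[>] 0) (𝓝 2) := by
  have ht : Tendsto (fun t : ℝ => t) (𝓝[>] 0) (𝓝 0) := nhdsWithin_le_nhds
  have hlog : Tendsto (fun t : ℝ => Real.log t * t) (𝓝[>] 0) (𝓝 0) := by
    have h := (Real.continuous_mul_log.tendsto 0).mono_left (nhdsWithin_le_nhds (s := Set.Ioi 0))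
    simpa [mul_comm] using h
  have h : Tendsto (fun t : ℝ => 2 + 1 / 3 * (Real.log 2 * t - Real.log t * t)
      + t * (t / 36 - t ^ 2 / 540 - t ^ 3 / 7776)) (𝓝[>] 0)
      (𝓝 (2 + 1 / 3 * (Real.log 2 * 0 - 0) + 0 * (0 / 36 - 0 ^ 2 / 540 - 0 ^ 3 / 7776))) :=
    ((((ht.const_mul _).sub hlog).const_mul _).const_add 2).add
      (ht.mul (((ht.div_const _).sub ((ht.pow 2).div_const _)).sub ((ht.pow 3).div_const _)))
  norm_num at h
  refine h.congr' ?_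
  filter_upwards [self_mem_nhdsWithin] with t ht
  have : t ≠ 0 := ne_of_gt ht
  rw [abel, Real.log_div two_ne_zero this]
  field_simp
  ring

lemma abel_iterate_sub (h0 : 0 < x 0) (hx : ∀ n, x (n + 1) = Real.log (1 + x n)) :
    (fun n => abel (x (n + 1)) - abel (x n) - 1) =O[atTop] (fun n => x n ^ 5) := by
  simp only [hx]
  exact abel_log_sub.comp_tendsto (iterate_tendsto h0 hx)

/-- The increments of $A(x_n)$ tend to $1$, so $A(x_n)/n\to1$ by Cesàro; dividing $x_nA(x_n)\to2$ by
this gives the limit. -/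
lemma tendsto_natCast_mul_iterate (h0 : 0 < x 0) (hx : ∀ n, x (n + 1) = Real.log (1 + x n)) :
    Tendsto (fun n : ℕ => n * x n) atTop (𝓝 2) := by
  have hlim := iterate_tendsto h0 hx
  have hlim0 : Tendsto x atTop (𝓝 0) := hlim.mono_right nhdsWithin_le_nhds
  have h1 : Tendsto (fun n => abel (x (n + 1)) - abel (x n)) atTop (𝓝 1) := by
    have := (abel_iterate_sub h0 hx).trans_tendsto (by simpa using hlim0.pow 5)
    simpa using this.add_const 1
  have h2 := h1.cesaro
  simp only [Finset.sum_range_sub (fun n => abel (x n))] at h2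
  have h3 : Tendsto (fun n : ℕ => (n : ℝ)⁻¹ * abel (x n)) atTop (𝓝 1) := by
    have h4 : Tendsto (fun n : ℕ => (n : ℝ)⁻¹ * abel (x 0)) atTop (𝓝 0) := by
      simpa using (tendsto_inv_atTop_nhds_zero_nat (𝕜 := ℝ)).mul_const (abel (x 0))
    have := h2.add h4
    rw [add_zero] at this
    exact this.congr fun n => by ring
  have h5 := (tendsto_mul_abel.comp hlim).div h3 one_ne_zero
  rw [div_one] at h5
  refine h5.congr' ?_
  filter_upwards [h3.eventually_ne one_ne_zero, eventually_ne_atTop 0] with n hn hn0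
  have hn0' : (n : ℝ) ≠ 0 := Nat.cast_ne_zero.2 hn0
  have : abel (x n) ≠ 0 := right_ne_zero_of_mul hn
  simp only [Pi.div_apply, Function.comp]
  field_simp

lemma iterate_isBigO (h0 : 0 < x 0) (hx : ∀ n, x (n + 1) = Real.log (1 + x n)) :
    x =O[atTop] (fun n : ℕ => 1 / (n : ℝ)) := by
  refine isBigO_of_eventually_eq_mul ((tendsto_natCast_mul_iterate h0 hx).isBigO_one ℝ) ?_
  filter_upwards [eventually_ne_atTop 0] with n hn
  have hn0' : (n : ℝ) ≠ 0 := Nat.cast_ne_zero.2 hn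
  field_simp

end Iteration

/-! ### The constant: existence and uniqueness -/

/-- Comparison with the telescoping sequence $1/n^4$ shows that $u$ is Cauchy and bounds the
distance to its limit. -/
lemma exists_limit_of_sub_isBigO {u : ℕ → ℝ}
    (hu : (fun n => u (n + 1) - u n) =O[atTop] (fun n : ℕ => 1 / (n : ℝ) ^ 5)) :
    ∃ K, (fun n => u n - K) =O[atTop] (fun n : ℕ => 1 / (n : ℝ) ^ 4) := by
  obtain ⟨A, hA0, hA⟩ := hu.exists_nonneg
  obtain ⟨N, hN⟩ := eventually_atTop.1 (hA.bound.and (eventually_ge_atTop 1))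
  have hstep : ∀ n ≥ N, |u (n + 1) - u n| ≤
      4 * A * (1 / (n : ℝ) ^ 4 - 1 / ((n + 1 : ℕ) : ℝ) ^ 4) := by
    intro n hn
    obtain ⟨h1, h2⟩ := hN n hn
    have hn1 : (1 : ℝ) ≤ n := by exact_mod_cast h2
    have hn0 : (0 : ℝ) < n := by linarith
    rw [Real.norm_eq_abs, Real.norm_of_nonneg (by positivity)] at h1
    -- The constant $4$ is generous: after clearing denominators and putting $n=1+d$, all
    -- coefficients in $d$ are positive.
    have key : 1 / (n : ℝ) ^ 5 ≤ 4 * (1 / (n : ℝ) ^ 4 - 1 / ((n + 1 : ℕ) : ℝ) ^ 4) := by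
      push_cast
      have e : 4 * (1 / (n : ℝ) ^ 4 - 1 / ((n : ℝ) + 1) ^ 4) - 1 / (n : ℝ) ^ 5 =
          (4 * n * ((n + 1) ^ 4 - n ^ 4) - (n + 1) ^ 4) / ((n : ℝ) ^ 5 * (n + 1) ^ 4) := by
        field_simp
      rw [← sub_nonneg, e]
      refine div_nonneg ?_ (by positivity)
      obtain ⟨d, hd⟩ : ∃ d : ℝ, (n : ℝ) = 1 + d := ⟨n - 1, by ring⟩
      have hd0 : 0 ≤ d := by linarith
      rw [hd]
      ring_nf
      positivity
    calc |u (n + 1) - u n| ≤ A * (1 / (n : ℝ) ^ 5) := h1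
      _ ≤ A * (4 * (1 / (n : ℝ) ^ 4 - 1 / ((n + 1 : ℕ) : ℝ) ^ 4)) := by gcongr
      _ = _ := by ring
  have htel : ∀ n ≥ N, ∀ m ≥ n, |u m - u n| ≤ 4 * A * (1 / (n : ℝ) ^ 4 - 1 / (m : ℝ) ^ 4) := by
    intro n hn m hm
    induction m, hm using Nat.le_induction with
    | base => simp
    | succ m hm ih =>
      have := hstep m (hn.trans hm)
      calc |u (m + 1) - u n| ≤ |u (m + 1) - u m| + |u m - u n| := abs_sub_le _ _ _
        _ ≤ _ := by linarith
  have htel' : ∀ n ≥ N, ∀ m ≥ n, |u m - u n| ≤ 4 * A * (1 / (n : ℝ) ^ 4) := fun n hn m hm =>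
    (htel n hn m hm).trans (by gcongr; linarith [show 0 ≤ 1 / (m : ℝ) ^ 4 by positivity])
  have hlim0 : Tendsto (fun n : ℕ => 4 * A * (1 / (n : ℝ) ^ 4)) atTop (𝓝 0) := by
    have h := ((tendsto_inv_atTop_nhds_zero_nat (𝕜 := ℝ)).pow 4).const_mul (4 * A)
    simpa using h
  have hcau : CauchySeq (fun k => u (k + N)) :=
    cauchySeq_of_le_tendsto_0' (fun k : ℕ => 4 * A * (1 / ((k + N : ℕ) : ℝ) ^ 4))
      (fun k m hkm => by
        rw [dist_comm, Real.dist_eq]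
        exact htel' _ (by omega) _ (by omega))
      (hlim0.comp (tendsto_add_atTop_nat N))
  obtain ⟨K, hK⟩ := cauchySeq_tendsto_of_complete hcau
  have hK' : Tendsto u atTop (𝓝 K) := (tendsto_add_atTop_iff_nat N).1 hK
  refine ⟨K, IsBigO.of_bound (4 * A) ?_⟩
  filter_upwards [eventually_ge_atTop N] with n hn
  rw [Real.norm_eq_abs, Real.norm_of_nonneg (by positivity), abs_sub_comm]
  exact le_of_tendsto (hK'.sub_const (u n)).abs
    ((eventually_ge_atTop n).mono fun m hm => htel' n hn m hm)

lemma one_le_log_eventually : ∀ᶠ n : ℕ in atTop, 1 ≤ Real.log n :=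
  (Real.tendsto_log_atTop.comp tendsto_natCast_atTop_atTop).eventually_ge_atTop 1

lemma exists_iterate_sub_logExpansion {x : ℕ → ℝ} (h0 : 0 < x 0)
    (hx : ∀ n, x (n + 1) = Real.log (1 + x n)) :
    ∃ C, (fun n => x n - logExpansion C n) =O[atTop]
      (fun n : ℕ => Real.log n ^ 5 / (n : ℝ) ^ 6) := by
  have hpos := iterate_pos h0 hx
  have hlim0 : Tendsto x atTop (𝓝 0) :=
    (iterate_tendsto h0 hx).mono_right nhdsWithin_le_nhds
  have hxO := iterate_isBigO h0 hx
  obtain ⟨K, hK⟩ := exists_limit_of_sub_isBigO (u := fun n => abel (x n) - n) (by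
    refine ((abel_iterate_sub h0 hx).trans (hxO.pow 5)).congr (fun n => ?_) fun n => ?_
    · push_cast; ring
    · rw [div_pow, one_pow])
  -- The expansion with constant $C$ has Abel value $n+2C$ up to the error, hence $C=K/2$.
  obtain ⟨w, hw1, hw, hwO⟩ := exists_logExpansion_factor (K / 2)
  refine ⟨K / 2, ?_⟩
  have hK2 : (fun n => abel (x n) - n - K) =O[atTop]
      (fun n : ℕ => Real.log n ^ 5 / (n : ℝ) ^ 4) := by
    refine hK.trans (IsBigO.of_bound 1 ?_)
    filter_upwards [one_le_log_eventually] with n hn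
    rw [one_mul, Real.norm_of_nonneg (by positivity), Real.norm_of_nonneg (by positivity)]
    gcongr
    exact one_le_pow₀ hn
  have hdiff : (fun n => abel (x n) - abel (2 / n * w n)) =O[atTop]
      (fun n : ℕ => Real.log n ^ 5 / (n : ℝ) ^ 4) :=
    (hK2.sub hwO).congr_left fun n => by ring
  have hyO : (fun n : ℕ => 2 / n * w n) =O[atTop] (fun n : ℕ => 1 / (n : ℝ)) :=
    isBigO_of_eventually_eq_mul (isBigO_one_mul (isBigO_one_const 2) (hw1.isBigO_one ℝ))
      (.of_forall fun n => by ring)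
  have hy0 : Tendsto (fun n : ℕ => 2 / n * w n) atTop (𝓝 0) :=
    hyO.trans_tendsto tendsto_one_div_atTop_nhds_zero_nat
  have hle : (fun n => x n - logExpansion (K / 2) n) =O[atTop]
      (fun n : ℕ => x n * (2 / n * w n) * (abel (x n) - abel (2 / n * w n))) := by
    refine IsBigO.of_bound 1 ?_
    filter_upwards [hlim0.eventually_le_const one_pos, hy0.eventually_le_const one_pos,
      hw1.eventually_const_lt one_pos, eventually_ge_atTop 2] with n hx1 hy1 hwn hn
    have hypos : 0 < 2 / n * w n := by positivity
    rw [hw n hn, one_mul, norm_mul, Real.norm_of_nonneg (mul_pos (hpos n) hypos).le]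
    exact abs_sub_le_mul_abel_sub (hpos n) hypos hx1 hy1
  refine (hle.trans ((hxO.mul hyO).mul hdiff)).congr_right fun n => ?_
  -- At $n=0$ both sides vanish, as division by zero gives $0$.
  rcases eq_or_ne (n : ℝ) 0 with h | h
  · simp [h]
  · field_simp

/-- Multiplied by $n^2$, the difference of the two expansions tends to $-4(C-D)$, while the error
bound forces it to $0$. -/
lemma logExpansion_injective {x : ℕ → ℝ} {C D : ℝ}
    (hC : (fun n => x n - logExpansion C n) =O[atTop]
      (fun n : ℕ => Real.log n ^ 5 / (n : ℝ) ^ 6))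
    (hD : (fun n => x n - logExpansion D n) =O[atTop]
      (fun n : ℕ => Real.log n ^ 5 / (n : ℝ) ^ 6)) : C = D := by
  have ht : Tendsto (fun n : ℕ => (1 : ℝ) / n) atTop (𝓝 0) := tendsto_one_div_atTop_nhds_zero_nat
  have hε := tendsto_log_div_natCast
  have hO := (isBigO_refl (fun n : ℕ => (n : ℝ) ^ 2) atTop).mul (hD.sub hC)
  have hr : Tendsto (fun n : ℕ => (n : ℝ) ^ 2 * (Real.log n ^ 5 / (n : ℝ) ^ 6)) atTop (𝓝 0) := by
    have h := ((Real.isLittleO_pow_log_id_atTop (n := 5)).tendsto_div_nhds_zero.comp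
      tendsto_natCast_atTop_atTop).mul (ht.pow 3)
    rw [zero_mul] at h
    refine h.congr' ?_
    filter_upwards [eventually_ne_atTop 0] with n hn
    have hn' : (n : ℝ) ≠ 0 := Nat.cast_ne_zero.2 hn
    simp only [Function.comp, id]
    field_simp
  have hz := hO.trans_tendsto hr
  -- $F(\ln n/n,\,1/n)$ is that difference times $n^2$; the terms free of the constant have
  -- cancelled, so $F$ is a polynomial and continuity gives its limit $F(0,0)$.
  obtain ⟨F, hF⟩ : ∃ F : ℝ × ℝ → ℝ, ∀ p, F p = -4 * (C - D)
      - 8 / 3 * (C - D) * p.1 + (8 * (C ^ 2 - D ^ 2) + 4 / 3 * (C - D)) * p.2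
      - 4 / 3 * (C - D) * p.1 ^ 2
      + (8 * (C ^ 2 - D ^ 2) + 20 / 9 * (C - D)) * (p.1 * p.2)
      - (16 * (C ^ 3 - D ^ 3) + 20 / 3 * (C ^ 2 - D ^ 2) + 10 / 9 * (C - D)) * p.2 ^ 2
      - 16 / 27 * (C - D) * p.1 ^ 3
      + (16 / 3 * (C ^ 2 - D ^ 2) + 52 / 27 * (C - D)) * (p.1 ^ 2 * p.2)
      - (64 / 3 * (C ^ 3 - D ^ 3) + 104 / 9 * (C ^ 2 - D ^ 2) + 20 / 9 * (C - D))
        * (p.1 * p.2 ^ 2)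
      + (32 * (C ^ 4 - D ^ 4) + 208 / 9 * (C ^ 3 - D ^ 3) + 20 / 3 * (C ^ 2 - D ^ 2)
        + 106 / 135 * (C - D)) * p.2 ^ 3 := ⟨_, fun _ => rfl⟩
  have hcont : Continuous F := by rw [funext hF]; fun_prop
  have hlim := (hcont.tendsto (0, 0)).comp (hε.prodMk_nhds ht)
  have heq : F (0, 0) = 0 := by
    refine tendsto_nhds_unique (hlim.congr' ?_) hz
    filter_upwards [eventually_ne_atTop 0] with n hn
    have hn' : (n : ℝ) ≠ 0 := Nat.cast_ne_zero.2 hn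
    rw [Function.comp, hF, logExpansion, logExpansion]
    field_simp
    ring
  rw [hF] at heq
  norm_num at heq
  linarith

end IterAsymp

theorem mainTheorem5 :
    (IterAsymp.lam 1 IterAsymp.logCoeff = 2 ∧
      IterAsymp.b 1 IterAsymp.logCoeff 1 = -1 / 3 ∧
      IterAsymp.P 1 IterAsymp.logCoeff 1 = Polynomial.X ∧
      IterAsymp.P 1 IterAsymp.logCoeff 2 =
        Polynomial.X ^ 2 - Polynomial.C (1 / 3) * Polynomial.X + Polynomial.C (1 / 18) ∧
      IterAsymp.P 1 IterAsymp.logCoeff 3 =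
        Polynomial.X ^ 3 - Polynomial.C (5 / 6) * Polynomial.X ^ 2
          + Polynomial.C (5 / 18) * Polynomial.X - Polynomial.C (7 / 270) ∧
      IterAsymp.P 1 IterAsymp.logCoeff 4 =
        Polynomial.X ^ 4 - Polynomial.C (13 / 9) * Polynomial.X ^ 3
          + Polynomial.C (5 / 6) * Polynomial.X ^ 2
          - Polynomial.C (53 / 270) * Polynomial.X + Polynomial.C (67 / 4860)) ∧
    ∀ x : ℕ → ℝ, 0 < x 0 → (∀ n : ℕ, x (n + 1) = Real.log (1 + x n)) →
      ∃! C : ℝ,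
        (fun n : ℕ => x n - IterAsymp.formulaA 1 IterAsymp.logCoeff 4 (2 * C) n)
            =O[Filter.atTop] (fun n : ℕ => Real.log n ^ 5 / (n : ℝ) ^ 6) ∧
        (fun n : ℕ => x n - IterAsymp.logExpansion C n)
            =O[Filter.atTop] (fun n : ℕ => Real.log n ^ 5 / (n : ℝ) ^ 6) := by
  refine ⟨⟨IterAsymp.lam_log, IterAsymp.b_log.1, IterAsymp.P_one _ _, IterAsymp.P_log_two,
    IterAsymp.P_log_three, IterAsymp.P_log_four⟩, fun x h0 hx => ?_⟩
  obtain ⟨C, hC⟩ := IterAsymp.exists_iterate_sub_logExpansion h0 hx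
  refine ⟨C, ⟨hC.congr' ?_ .rfl, hC⟩, fun D hD => IterAsymp.logExpansion_injective hD.2 hC⟩
  filter_upwards [eventually_ne_atTop 0] with n hn
  rw [IterAsymp.formulaA_log C hn]
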